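/- For a finite simple graph $G$ let $\mathrm{FRAC}(G)=\{x\in[0,1]^{V(G)} : x_i+x_j\le 1 \text{ for all } \{i,j\}\in E(G)\}$, and for $P\subseteq[0,1]^V$ let $P_I=\operatorname{conv}(P\cap\{0,1\}^V)$ and $\operatorname{cone}(P)=\{(\lambda,\lambda x) : \lambda\ge 0,\ x\in P\}\subseteq\mathbb{R}^{\{0\}\cup V}$. Let $\mathrm{LS}_+(P)$ be the set of all $x\in\mathbb{R}^V$ for which there is a real symmetric positive semidefinite matrix $Y$ indexed by $\{0\}\cup V$ with $Ye_0=\operatorname{diag}(Y)=(1,x)$ and $Ye_i,\ Y(e_0-e_i)\in\operatorname{cone}(P)$ for all $i\in V$. Let $\mathrm{LS}_+^k$ denote its $k$-fold iterate. The $\mathrm{LS}_+$-rank $r_+(G)$ is the smallest $k\ge 0$ with $\mathrm{LS}_+^k(\mathrm{FRAC}(G))=\mathrm{FRAC}(G)_I$, and $G$ is called $\ell$-minimal if $r_+(G)=\ell$ and $|V(G)|=3\ell$. To $2$-stretch a vertex $v$ of a graph $G$ means to choose sets $A_1,A_2$ (possibly empty, not necessarily disjoint) whose union is the neighborhood of $v$,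 to replace $v$ by a hub $v_0$ and two wings $v_1,v_2$, and to join $v_j$ to $v_0$ and to all vertices of $A_j$, for $j=1,2$. Let $\mathcal{K}_{n,d}$ be the class of graphs that are, up to isomorphism, obtained from the complete graph on $\{1,\dots,n\}$ by $2$-stretching $d$ of its $n$ vertices, one after the other, and let $\hat{\mathcal{K}}_{n,d}$ be the class of those for which this can be done so that, for any two distinct stretched vertices $i,j$, exactly one of the pairs $\{i_1,j_1\},\{i_1,j_2\},\{i_2,j_1\},\{i_2,j_2\}$ is an edge of the resulting graph. **Proposition.** Let $G$ be the graph on the nine vertices $1,2,3,4_0,4_1,4_2,5_0,5_1,5_2$ with the sixteen edges $$12,\ 13,\ 23,\ 4_04_1,\ 4_04_2,\ 5_05_1,\ 5_05_2,\ 4_13,\ 4_21,\ 4_22,\ 5_12,\ 5_13,\ 5_21,\ 5_22,\ 5_14_1,\ 5_14_2 .$$ Then $G\in\mathcal{K}_{5,2}\setminus\hat{\mathcal{K}}_{5,2}$, and $G$ is $3$-minimal. In particular, not every $\ell$-minimal graph belongs to $\hat{\mathcal{K}}_{\ell+2,\ell-1}$. -/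

import Mathlib

namespace LSPlus

/-! ### The Lovász–Schrijver operator `LS₊` -/

section Operator

variable {V : Type*}

/-- The homogenized cone `{(t, t x) : t ≥ 0, x ∈ P}` of a set `P ⊆ ℝ^V`. The extra coordinate
(indexed by `0` in the literature) is `none : Option V`. -/
def homCone (P : Set (V → ℝ)) : Set (Option V → ℝ) :=
  {y | ∃ t : ℝ, 0 ≤ t ∧ ∃ x ∈ P, y none = t ∧ ∀ i : V, y (some i) = t * x i}

/-- The lifted set: symmetric positive semidefinite matrices `Y`, indexed by `Option V`, such that
the column `Y e₀` equals the diagonal of `Y`, and for every `i` both the column `Y eᵢ` and the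
difference of columns `Y (e₀ - eᵢ)` lie in the homogenized cone of `P`. -/
def liftedLS (P : Set (V → ℝ)) : Set (Matrix (Option V) (Option V) ℝ) :=
  {Y | Y.PosSemidef ∧ (∀ a, Y a none = Y a a) ∧
    ∀ i : V, (fun a => Y a (some i)) ∈ homCone P ∧
      (fun a => Y a none - Y a (some i)) ∈ homCone P}

/-- The operator `LS₊`: all `x` with `Y e₀ = (1, x)` for some `Y` in the lifted set. -/
def LS (P : Set (V → ℝ)) : Set (V → ℝ) :=
  {x | ∃ Y ∈ liftedLS P, Y none none = 1 ∧ ∀ i : V, Y (some i) none = x i}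

/-- The integer hull `conv (P ∩ {0,1}^V)`. -/
def integerHull (P : Set (V → ℝ)) : Set (V → ℝ) :=
  convexHull ℝ {x | x ∈ P ∧ ∀ i, x i = 0 ∨ x i = 1}

/-- `P` has `LS₊`-rank `k`: `k` is the smallest natural number such that `k` successive
applications of `LS₊` to `P` yield the integer hull of `P`. -/
def HasLSRank (P : Set (V → ℝ)) (k : ℕ) : Prop :=
  IsLeast {m : ℕ | LS^[m] P = integerHull P} k

/-- The fractional stable set polytope of a graph. Its integer hull is the stable set polytope. -/
def FRAC (G : SimpleGraph V) : Set (V → ℝ) :=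
  {x | (∀ i, 0 ≤ x i ∧ x i ≤ 1) ∧ ∀ i j, G.Adj i j → x i + x j ≤ 1}

/-- `G` is `ℓ`-minimal: it has `3ℓ` vertices and its `LS₊`-rank, i.e. that of its fractional stable
set polytope, is `ℓ`. -/
def IsMinimal (G : SimpleGraph V) (l : ℕ) : Prop :=
  HasLSRank (FRAC G) l ∧ Finite V ∧ Nat.card V = 3 * l

end Operator

/-! ### Vertex stretching and stretched cliques -/

/-- The adjacency relation after stretching the vertex `v` of `G` with respect to the family `A`:
`v` is replaced by a hub (`none`) and one new vertex for each index `j` (`some j`), the latter being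
joined to the hub and to all vertices in `A j`. -/
def stretchAdj {V J : Type} (G : SimpleGraph V) (v : V) (A : J → Set V) :
    {w : V // w ≠ v} ⊕ Option J → {w : V // w ≠ v} ⊕ Option J → Prop
  | .inl a, .inl b => G.Adj a b
  | .inl a, .inr (some j) => (a : V) ∈ A j
  | .inr (some j), .inl a => (a : V) ∈ A j
  | .inr none, .inr (some _) => True
  | .inr (some _), .inr none => True
  | _, _ => False

/-- The graph obtained from `G` by stretching the vertex `v` with respect to the family `A`. -/
def stretch {V J : Type} (G : SimpleGraph V) (v : V) (A : J → Set V) :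
    SimpleGraph ({w : V // w ≠ v} ⊕ Option J) where
  Adj := stretchAdj G v A
  symm := ⟨by
    rintro (a | _ | i) (b | _ | j) h <;> simp_all [stretchAdj, SimpleGraph.adj_comm]⟩
  loopless := ⟨by rintro (a | _ | i) h <;> simp_all [stretchAdj]⟩

/-- Names for the vertices of a graph obtained by `2`-stretching vertices of `K_n`: an unstretched
vertex `i`, the hub `i₀`, or one of the two wings `i₁, i₂` (the latter indexed by `Fin 2`). -/
inductive Label (n : ℕ) : Type
  | unstretched (i : Fin n)
  | hub (i : Fin n)
  | wing (i : Fin n) (a : Fin 2)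

/-- The labels after `2`-stretching the vertex `v` with name `i`. -/
def stretchLabel {n : ℕ} {V : Type} (L : V → Label n) (v : V) (i : Fin n) :
    {w : V // w ≠ v} ⊕ Option (Fin 2) → Label n
  | .inl w => L w
  | .inr none => .hub i
  | .inr (some a) => .wing i a

/-- `StretchedClique n d G L`: the graph `G`, with its vertices named by `L`, arises from the
complete graph `K_n` by successively `2`-stretching `d` of the `n` original vertices. -/
inductive StretchedClique (n : ℕ) :
    ℕ → (V : Type) → SimpleGraph V → (V → Label n) → Prop
  | complete : StretchedClique n 0 (Fin n) ⊤ Label.unstretched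
  | stretch {d : ℕ} {V : Type} {G : SimpleGraph V} {L : V → Label n}
      (hG : StretchedClique n d V G L) (v : V) (i : Fin n) (hv : L v = .unstretched i)
      (A : Fin 2 → Set V) (hA : ⋃ a, A a = G.neighborSet v) :
      StretchedClique n (d + 1) _ (stretch G v A) (stretchLabel L v i)

/-- The class `𝒦_{n,d}` of all graphs which are, up to isomorphism, obtained from `K_n` by
`2`-stretching `d` of its vertices. -/
def MemK (n d : ℕ) {V : Type} (G : SimpleGraph V) : Prop :=
  ∃ (W : Type) (H : SimpleGraph W) (L : W → Label n),
    StretchedClique n d W H L ∧ Nonempty (G ≃g H)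

/-- For any two distinct stretched indices `i, j`, exactly one of the four pairs consisting of a
wing of `i` and a wing of `j` is an edge. -/
def SingleWingEdges {n : ℕ} {W : Type} (H : SimpleGraph W) (L : W → Label n) : Prop :=
  ∀ i j : Fin n, i ≠ j → (∃ u, L u = .hub i) → (∃ u, L u = .hub j) →
    {e ∈ H.edgeSet | ∃ (u w : W) (a b : Fin 2),
      L u = .wing i a ∧ L w = .wing j b ∧ e = s(u, w)}.ncard = 1

/-- The class `𝒦̂_{n,d}` of all graphs which are, up to isomorphism, obtained from `K_n` by
`2`-stretching `d` of its vertices in such a way that any two distinct stretched indices have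
exactly one edge between their wings. -/
def MemKHat (n d : ℕ) {V : Type} (G : SimpleGraph V) : Prop :=
  ∃ (W : Type) (H : SimpleGraph W) (L : W → Label n),
    StretchedClique n d W H L ∧ SingleWingEdges H L ∧ Nonempty (G ≃g H)

/-- The specific stretched clique on nine vertices. In terms of the names of vertices of a graph
obtained from `K_5` by stretching the vertices `4` and `5`, the vertices `0, 1, …, 8` are
`1, 2, 3, 4₁, 4₀, 4₂, 5₁, 5₀, 5₂`, in this order. -/
def nineGraph : SimpleGraph (Fin 9) :=
  SimpleGraph.fromEdgeSet
    {s(0, 1), s(1, 2), s(0, 2), s(3, 4), s(4, 5), s(6, 7), s(7, 8), s(3, 2), s(5, 0), s(5, 1),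
      s(6, 1), s(6, 2), s(8, 0), s(8, 1), s(6, 5), s(6, 3)}

end LSPlus

/-! Membership in `𝒦_{5,2}` is witnessed by two explicit stretchings. The graph is outside
`𝒦̂_{5,2}` because its hubs are forced: in a stretched clique the neighbors of a hub are exactly its
two wings (`StretchedClique.hub_spec`), and only the vertices `4` and `7` (`4₀` and `5₀`) have
degree two. Hence the wings are forced as well, and both `4₁5₁` and `4₂5₁` join wings of different
indices.

Rank at most `3`: each application of `LS` writes a point as a convex combination of points at which
one chosen coordinate is binary (`mem_of_mem_iterate_LS`). Once the coordinates of `2`, `4₂`, `5₁`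
are binary, the remaining graph is a path, and the bipartite case applies
(`mem_integerHull_of_bipartite`).

Rank at least `3`: the stability number is at most `3`, so `∑ xᵢ ≤ 3` holds on the stable set
polytope, while an explicit point of `LS (LS (FRAC nineGraph))` has coordinate sum `60009 / 20000`.
Its certificate is one integer matrix for the outer application and eighteen for the columns `Y eᵢ`
and `Y (e₀ - eᵢ)`, verified by exact arithmetic (`mem_LS_LS_of_secondLiftCheck`). As the iterates of
`LS` decrease, no smaller rank is possible either. -/

open Finset

namespace LSPlus

/-! ### General properties of the operator: convexity, monotonicity, splitting along coordinates. -/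

section Operator

variable {V : Type*} {P Q : Set (V → ℝ)}

theorem smul_mem_homCone {y : Option V → ℝ} (hy : y ∈ homCone P) {c : ℝ} (hc : 0 ≤ c) :
    (fun a => c * y a) ∈ homCone P := by
  obtain ⟨t, ht, x, hx, h0, h1⟩ := hy
  exact ⟨c * t, by positivity, x, hx, by simp [h0], fun i => by simp [h1, mul_assoc]⟩

theorem add_mem_homCone (hP : Convex ℝ P) {y z : Option V → ℝ} (hy : y ∈ homCone P)
    (hz : z ∈ homCone P) : (fun a => y a + z a) ∈ homCone P := by
  obtain ⟨s, hs, x, hx, hx0, hx1⟩ := hy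
  obtain ⟨t, ht, w, hw, hw0, hw1⟩ := hz
  rcases eq_or_lt_of_le (add_nonneg hs ht) with h | h
  · have hs0 : s = 0 := by linarith
    have ht0 : t = 0 := by linarith
    exact ⟨0, le_rfl, x, hx, by simp [hx0, hw0, hs0, ht0], fun i => by simp [hx1, hw1, hs0, ht0]⟩
  · refine ⟨s + t, h.le, (s / (s + t)) • x + (t / (s + t)) • w,
      hP hx hw (by positivity) (by positivity) (by field_simp), by simp [hx0, hw0], fun i => ?_⟩
    simp only [hx1, hw1, Pi.add_apply, Pi.smul_apply, smul_eq_mul]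
    field_simp

theorem mem_of_mem_homCone {y : Option V → ℝ} (hy : y ∈ homCone P) (h0 : y none = 1) :
    (fun i => y (some i)) ∈ P := by
  obtain ⟨t, -, x, hx, hx0, hx1⟩ := hy
  have : t = 1 := hx0.symm.trans h0
  simpa [hx1, this] using hx

theorem convex_LS (hP : Convex ℝ P) : Convex ℝ (LS P) := by
  rintro x ⟨Y, ⟨hY, hYd, hYc⟩, hY0, hYx⟩ z ⟨Z, ⟨hZ, hZd, hZc⟩, hZ0, hZx⟩ a b ha hb hab
  refine ⟨a • Y + b • Z, ⟨(hY.smul ha).add (hZ.smul hb), fun c => ?_, fun i => ⟨?_, ?_⟩⟩, ?_,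
    fun i => ?_⟩
  · simp [← hYd, ← hZd]
  · simpa using add_mem_homCone hP (smul_mem_homCone (hYc i).1 ha) (smul_mem_homCone (hZc i).1 hb)
  · convert add_mem_homCone hP (smul_mem_homCone (hYc i).2 ha) (smul_mem_homCone (hZc i).2 hb)
      using 2
    simp only [Matrix.add_apply, Matrix.smul_apply, smul_eq_mul]
    ring
  · simp [hY0, hZ0, hab]
  · simp [hYx, hZx]

theorem convex_iterate_LS (hP : Convex ℝ P) (k : ℕ) : Convex ℝ (LS^[k] P) := by
  induction k with
  | zero => exact hP
  | succ k ih => rw [Function.iterate_succ_apply']; exact convex_LS ih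

theorem liftedLS_symm {Y : Matrix (Option V) (Option V) ℝ} (hY : Y ∈ liftedLS P)
    (a b : Option V) : Y a b = Y b a := by
  simpa using (hY.1.1.apply a b).symm

/-- A point of `LS P` is, for every coordinate, a convex combination of two points of `P` at
which this coordinate is `1` and `0`, respectively. -/
theorem exists_split_of_mem_LS {x : V → ℝ} (hx : x ∈ LS P) (w : V) :
    ∃ s t : ℝ, 0 ≤ s ∧ 0 ≤ t ∧ s + t = 1 ∧ ∃ y ∈ P, ∃ z ∈ P, x = s • y + t • z ∧
      (s ≠ 0 → y w = 1) ∧ (t ≠ 0 → z w = 0) := by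
  obtain ⟨Y, hY, h0, hYx⟩ := hx
  obtain ⟨⟨s, hs, y, hy, hy0, hy1⟩, ⟨t, ht, z, hz, hz0, hz1⟩⟩ := hY.2.2 w
  -- The weight of column `w` is its diagonal entry. Comparing the entries at `w` then gives `s = s
  -- * y w` and `0 = t * z w`.
  have hsw : Y (some w) (some w) = s := by
    rw [← hy0, ← hY.2.1]; exact liftedLS_symm hY _ _
  refine ⟨s, t, hs, ht, by linarith, y, hy, z, hz, ?_, fun hs0 => ?_, fun ht0 => ?_⟩
  · ext i
    have := hy1 i
    have := hz1 i
    simp only [Pi.add_apply, Pi.smul_apply, smul_eq_mul, ← hYx]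
    linarith
  · have : Y (some w) (some w) = s * y w := hy1 w
    rw [hsw] at this
    exact mul_left_cancel₀ hs0 (by linarith)
  · have : Y (some w) none - Y (some w) (some w) = t * z w := hz1 w
    rw [hY.2.1, sub_self] at this
    exact mul_left_cancel₀ ht0 (by linarith)

theorem LS_subset (hP : Convex ℝ P) [Nonempty V] : LS P ⊆ P := by
  intro x hx
  obtain ⟨s, t, hs, ht, hst, y, hy, z, hz, rfl, -⟩ := exists_split_of_mem_LS hx
    (Classical.arbitrary V)
  exact hP hy hz hs ht hst

/-- The rank-one matrix `(1, x)(1, x)ᵀ` works: its diagonal is its first column since `xᵢ² = xᵢ`,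
and its columns are nonnegative multiples of `(1, x)`. -/
theorem mem_LS_of_binary [Fintype V] {x : V → ℝ} (hx : x ∈ P) (h : ∀ i, x i = 0 ∨ x i = 1) :
    x ∈ LS P := by
  classical
  let u : Option V → ℝ := fun a => a.elim 1 x
  refine ⟨Matrix.vecMulVec u (star u), ⟨Matrix.posSemidef_vecMulVec_self_star u, fun a => ?_,
    fun i => ⟨?_, ?_⟩⟩, ?_, fun i => ?_⟩
  · rcases a with _ | i
    · rfl
    · rcases h i with hi | hi <;> simp [Matrix.vecMulVec_apply, u, hi]
  · have : 0 ≤ x i := by rcases h i with hi | hi <;> simp [hi]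
    exact ⟨x i, this, x, hx, by simp [Matrix.vecMulVec_apply, u],
      fun j => by simp [Matrix.vecMulVec_apply, u, mul_comm]⟩
  · have : 0 ≤ 1 - x i := by rcases h i with hi | hi <;> simp [hi]
    exact ⟨1 - x i, this, x, hx, by simp [Matrix.vecMulVec_apply, u],
      fun j => by simp [Matrix.vecMulVec_apply, u]; ring⟩
  · simp [Matrix.vecMulVec_apply, u]
  · simp [Matrix.vecMulVec_apply, u]

theorem integerHull_subset_iterate_LS [Fintype V] (hP : Convex ℝ P) (k : ℕ) :
    integerHull P ⊆ LS^[k] P := by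
  refine convexHull_min ?_ (convex_iterate_LS hP k)
  rintro x ⟨hx, h⟩
  induction k with
  | zero => exact hx
  | succ k ih => rw [Function.iterate_succ_apply']; exact mem_LS_of_binary ih h

theorem iterate_LS_antitone (hP : Convex ℝ P) [Nonempty V] : Antitone fun k => LS^[k] P :=
  antitone_nat_of_succ_le fun k => by
    rw [Function.iterate_succ_apply']
    exact LS_subset (convex_iterate_LS hP k)

/-- Since `0` and `1` are extreme in `[0, 1]`, coordinates that are binary at a proper convex
combination are binary at both endpoints. Splitting along `w` therefore adds `w` to the binary
coordinates without losing those in `T`. -/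
theorem mem_of_split {C : Set (V → ℝ)} (hC : Convex ℝ C) {x : V → ℝ} (hx : x ∈ LS P) (w : V)
    {T : Set V} (hT : ∀ v ∈ T, x v = 0 ∨ x v = 1) (hP : ∀ y ∈ P, ∀ v, 0 ≤ y v ∧ y v ≤ 1)
    (h : ∀ y ∈ P, (∀ v ∈ insert w T, y v = 0 ∨ y v = 1) → y ∈ C) : x ∈ C := by
  obtain ⟨s, t, hs, ht, hst, y, hy, z, hz, rfl, hyw, hzw⟩ := exists_split_of_mem_LS hx w
  -- With a zero weight, the corresponding endpoint is an arbitrary point of `P`, but the other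
  -- endpoint is the given point itself.
  rcases eq_or_lt_of_le hs with rfl | hs
  · obtain rfl : t = 1 := by linarith
    simp only [zero_smul, one_smul, zero_add] at hT ⊢
    refine h z hz fun v hv => ?_
    rcases hv with rfl | hv
    · exact Or.inl (hzw one_ne_zero)
    · exact hT v hv
  rcases eq_or_lt_of_le ht with rfl | ht
  · obtain rfl : s = 1 := by linarith
    simp only [zero_smul, one_smul, add_zero] at hT ⊢
    refine h y hy fun v hv => ?_
    rcases hv with rfl | hv
    · exact Or.inr (hyw one_ne_zero)
    · exact hT v hv
  · have key : ∀ v ∈ T, (y v = 0 ∧ z v = 0) ∨ (y v = 1 ∧ z v = 1) := fun v hv => by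
      have h1 := hP y hy v
      have h2 := hP z hz v
      have h3 := hT v hv
      simp only [Pi.add_apply, Pi.smul_apply, smul_eq_mul] at h3
      rcases h3 with h3 | h3
      · left
        constructor <;> nlinarith [mul_nonneg hs.le h1.1, mul_nonneg ht.le h2.1]
      · right
        have := mul_nonneg hs.le (sub_nonneg.2 h1.2)
        have := mul_nonneg ht.le (sub_nonneg.2 h2.2)
        constructor <;> nlinarith
    refine hC (h y hy fun v hv => ?_) (h z hz fun v hv => ?_) hs.le ht.le hst
    · rcases hv with rfl | hv
      · exact Or.inr (hyw hs.ne')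
      · exact (key v hv).imp And.left And.left
    · rcases hv with rfl | hv
      · exact Or.inl (hzw ht.ne')
      · exact (key v hv).imp And.right And.right

/-- If fixing the coordinates in `l` to binary values forces points of `P` into the convex set
`C`, then `l.length` applications of `LS` lead into `C`. -/
theorem mem_of_mem_iterate_LS [Nonempty V] {C : Set (V → ℝ)} (hC : Convex ℝ C)
    (hPc : Convex ℝ P) (hP : ∀ y ∈ P, ∀ v, 0 ≤ y v ∧ y v ≤ 1) (l : List V) {T : Set V}
    (h : ∀ y ∈ P, (∀ v ∈ T, y v = 0 ∨ y v = 1) → (∀ v ∈ l, y v = 0 ∨ y v = 1) → y ∈ C)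
    {x : V → ℝ} (hx : x ∈ LS^[l.length] P) (hT : ∀ v ∈ T, x v = 0 ∨ x v = 1) : x ∈ C := by
  induction l generalizing T x with
  | nil => exact h x hx hT (by simp)
  -- The outermost application is spent on `w`; the set `T` accumulates the coordinates already made
  -- binary.
  | cons w l ih =>
    rw [List.length_cons, Function.iterate_succ_apply'] at hx
    refine mem_of_split hC hx w hT
      (fun y hy => hP y (iterate_LS_antitone hPc (Nat.zero_le l.length) hy)) fun y hy hyT => ?_
    refine ih (T := insert w T) (fun z hz hzT hzl => ?_) hy hyT
    refine h z hz (fun v hv => hzT v (Or.inr hv)) fun v hv => ?_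
    rcases List.mem_cons.1 hv with rfl | hv
    · exact hzT _ (Or.inl rfl)
    · exact hzl v hv

/-- The first column of a lifted matrix, without the normalization `Y₀₀ = 1`. -/
theorem mem_homCone_LS {Y : Matrix (Option V) (Option V) ℝ} (hY : Y ∈ liftedLS P)
    (h0 : 0 < Y none none) : (fun a => Y a none) ∈ homCone (LS P) := by
  have hc : 0 ≤ (Y none none)⁻¹ := by positivity
  refine ⟨Y none none, h0.le, fun i => (Y none none)⁻¹ * Y (some i) none,
    ⟨(Y none none)⁻¹ • Y, ⟨hY.1.smul hc, fun a => ?_, fun i => ⟨?_, ?_⟩⟩, ?_, fun i => rfl⟩, rfl,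
    fun i => by field_simp⟩
  · simp [hY.2.1 a]
  · exact smul_mem_homCone (hY.2.2 i).1 hc
  · convert smul_mem_homCone (hY.2.2 i).2 hc using 2
    simp [mul_sub]
  · simp [h0.ne']

end Operator

/-! ### Integrality of the fractional stable set polytope in the bipartite case. -/

section FRAC

variable {V : Type*} (G : SimpleGraph V)

theorem convex_FRAC : Convex ℝ (FRAC G) := by
  rintro x ⟨hx, hxE⟩ y ⟨hy, hyE⟩ a b ha hb hab
  refine ⟨fun i => ?_, fun i j hij => ?_⟩
  · have h1 := hx i
    have h2 := hy i
    simp only [Pi.add_apply, Pi.smul_apply, smul_eq_mul]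
    constructor
    · nlinarith [mul_nonneg ha h1.1, mul_nonneg hb h2.1]
    · nlinarith [mul_le_mul_of_nonneg_left h1.2 ha, mul_le_mul_of_nonneg_left h2.2 hb]
  · have h1 := hxE i j hij
    have h2 := hyE i j hij
    simp only [Pi.add_apply, Pi.smul_apply, smul_eq_mul]
    nlinarith [mul_le_mul_of_nonneg_left h1 ha, mul_le_mul_of_nonneg_left h2 hb]

theorem isClosed_FRAC : IsClosed (FRAC G) := by
  simp only [FRAC, Set.ofPred_and, Set.ofPred_forall]
  refine IsClosed.inter (isClosed_iInter fun i => ?_)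
    (isClosed_iInter fun i => isClosed_iInter fun j => isClosed_iInter fun _ => ?_)
  · exact (isClosed_le continuous_const (continuous_apply i)).inter
      (isClosed_le (continuous_apply i) continuous_const)
  · exact isClosed_le ((continuous_apply i).add (continuous_apply j)) continuous_const

theorem finite_binary [Finite V] : {x : V → ℝ | ∀ i, x i = 0 ∨ x i = 1}.Finite := by
  have : {x : V → ℝ | ∀ i, x i = 0 ∨ x i = 1} = Set.univ.pi fun _ => {0, 1} := by
    ext x; simp
  rw [this]
  exact Set.Finite.pi fun _ => Set.toFinite _

variable {G}

open Topology in
/-- If `G` is bipartite outside of `S`, then points of `FRAC G` that are binary on `S` lie in the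
stable set polytope. -/
theorem mem_integerHull_of_bipartite [Finite V] {S : Set V} (c : V → Bool)
    (hc : ∀ i j, G.Adj i j → i ∉ S → j ∉ S → c i ≠ c j) {y : V → ℝ} (hy : y ∈ FRAC G)
    (hyS : ∀ v ∈ S, y v = 0 ∨ y v = 1) : y ∈ integerHull (FRAC G) := by
  classical
  have := Fintype.ofFinite V
  let F : Set (V → ℝ) := {x | ∀ v ∈ S, x v = y v}
  have hFc : Convex ℝ F := by
    intro x hx z hz a b _ _ hab v hv
    simp only [Pi.add_apply, Pi.smul_apply, smul_eq_mul, hx v hv, hz v hv]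
    rw [← add_mul, hab, one_mul]
  have hFcl : IsClosed F := by
    simp only [F, Set.ofPred_forall]
    exact isClosed_iInter fun v => isClosed_iInter fun _ =>
      isClosed_eq (continuous_apply v) continuous_const
  have hcomp : IsCompact (FRAC G ∩ F) := by
    refine (isCompact_univ_pi fun _ : V => isCompact_Icc (a := (0 : ℝ)) (b := 1)).of_isClosed_subset
      ((isClosed_FRAC G).inter hFcl) fun x hx i _ => hx.1.1 i
  have hclosed : IsClosed (integerHull (FRAC G)) :=
    (finite_binary.subset fun x (hx : _ ∧ _) => hx.2).isClosed_convexHull (𝕜 := ℝ)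
  have hmem : y ∈ FRAC G ∩ F := ⟨hy, fun _ _ => rfl⟩
  -- Krein–Milman: it suffices that the extreme points of the slice `FRAC G ∩ F` are binary.
  rw [← closure_convexHull_extremePoints hcomp ((convex_FRAC G).inter hFc)] at hmem
  refine closure_minimal (convexHull_mono ?_) hclosed hmem
  intro x hx
  obtain ⟨⟨⟨hx01, hxE⟩, hxF⟩, hext⟩ := hx
  refine ⟨⟨hx01, hxE⟩, ?_⟩
  by_contra! hfrac
  obtain ⟨k, hk0, hk1⟩ := hfrac
  -- Shifting the fractional coordinates up on one color class and down on the other preserves `x i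
  -- + x j` on edges with two fractional ends. Small moves in both directions stay in the slice,
  -- contradicting extremality.
  let d : V → ℝ := fun i => if x i = 0 ∨ x i = 1 then 0 else if c i then 1 else -1
  have hd : ∀ i, |d i| ≤ 1 := fun i => by simp only [d]; split_ifs <;> simp
  have hev : ∀ᶠ ε : ℝ in 𝓝[>] 0, ∀ i, x i ≠ 0 → x i ≠ 1 → ε < x i ∧ ε < 1 - x i := by
    refine Filter.eventually_all.2 fun i => ?_
    by_cases h : x i = 0 ∨ x i = 1
    · exact Filter.Eventually.of_forall fun _ h0 h1 => absurd h (by tauto)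
    · push Not at h
      have h0 : 0 < x i := lt_of_le_of_ne (hx01 i).1 (Ne.symm h.1)
      have h1 : 0 < 1 - x i := sub_pos.2 (lt_of_le_of_ne (hx01 i).2 h.2)
      filter_upwards [nhdsWithin_le_nhds (gt_mem_nhds h0), nhdsWithin_le_nhds (gt_mem_nhds h1)]
        with ε e0 e1 _ _ using ⟨e0, e1⟩
  obtain ⟨ε, hε, hε0⟩ := (hev.and self_mem_nhdsWithin).exists
  replace hε0 : 0 < ε := hε0
  have move : ∀ σ : ℝ, |σ| = ε → x + σ • d ∈ FRAC G ∩ F := by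
    intro σ hσ
    obtain ⟨hσ1, hσ2⟩ := abs_le.1 hσ.le
    have bound : ∀ i, -ε ≤ σ * d i ∧ σ * d i ≤ ε := fun i => by
      rw [← abs_le, abs_mul, hσ]
      exact mul_le_of_le_one_right hε0.le (hd i)
    refine ⟨⟨fun i => ?_, fun i j hij => ?_⟩, fun v hv => ?_⟩
    · simp only [Pi.add_apply, Pi.smul_apply, smul_eq_mul]
      by_cases h : x i = 0 ∨ x i = 1
      · simp only [d, if_pos h, mul_zero, add_zero]; exact hx01 i
      · push Not at h
        have := hε i h.1 h.2
        have := bound i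
        constructor <;> linarith
    · simp only [Pi.add_apply, Pi.smul_apply, smul_eq_mul]
      have hE := hxE i j hij
      -- If only one end is fractional, the other end is `0`, since the value `1` would force the
      -- fractional end to be `0`; then the edge inequality has slack.
      by_cases hi : x i = 0 ∨ x i = 1
      · by_cases hj : x j = 0 ∨ x j = 1
        · simpa only [d, if_pos hi, if_pos hj, mul_zero, add_zero] using hE
        · simp only [d, if_pos hi, mul_zero, add_zero]
          push Not at hj
          have h1 := hε j hj.1 hj.2
          have h2 := (bound j).2
          have h3 := (hx01 j).1
          simp only [d] at h2
          rcases hi with hi | hi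
          · linarith
          · exact absurd (le_antisymm (by linarith) h3) hj.1
      · by_cases hj : x j = 0 ∨ x j = 1
        · simp only [d, if_pos hj, mul_zero, add_zero]
          push Not at hi
          have h1 := hε i hi.1 hi.2
          have h2 := (bound i).2
          have h3 := (hx01 i).1
          simp only [d] at h2
          rcases hj with hj | hj
          · linarith
          · exact absurd (le_antisymm (by linarith) h3) hi.1
        · have hiS : i ∉ S := fun h => hi (by rw [hxF i h]; exact hyS i h)
          have hjS : j ∉ S := fun h => hj (by rw [hxF j h]; exact hyS j h)
          have hcol := hc i j hij hiS hjS
          have : d i + d j = 0 := by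
            simp only [d, if_neg hi, if_neg hj]
            cases hci : c i <;> cases hcj : c j <;> simp_all
          linear_combination hE + σ * this
    · have h : x v = 0 ∨ x v = 1 := by rw [hxF v hv]; exact hyS v hv
      simp only [Pi.add_apply, Pi.smul_apply, smul_eq_mul, d, if_pos h, mul_zero, add_zero]
      exact hxF v hv
  have h1 := move ε (abs_of_pos hε0)
  have h2 := move (-ε) (by rw [abs_neg, abs_of_pos hε0])
  have h3 : x + ε • d = x := by
    refine (hext h1 h2 ⟨1 / 2, 1 / 2, by norm_num, by norm_num, by norm_num, ?_⟩)
    ext i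
    simp only [Pi.add_apply, Pi.smul_apply, smul_eq_mul]
    ring
  have h4 := congrFun h3 k
  simp only [Pi.add_apply, Pi.smul_apply, smul_eq_mul, add_eq_left, mul_eq_zero, hε0.ne',
    false_or, d, hk0, hk1, or_self, if_false] at h4
  split_ifs at h4 <;> norm_num at h4

end FRAC

/-! ### Soundness of the integer certificates. -/

section Certificates

/-- A fraction-free symmetric elimination: a sufficient condition for the positive semidefiniteness
of the leading `n × n` block of a symmetric integer matrix. -/
def psdCheck : ℕ → (ℕ → ℕ → ℤ) → Bool
  | 0, _ => true
  | n + 1, M =>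
    bif decide (M 0 0 = 0) then
      (List.range n).all (fun j => decide (M 0 (j + 1) = 0)) &&
        psdCheck n fun i j => M (i + 1) (j + 1)
    else
      decide (0 < M 0 0) &&
        psdCheck n fun i j => M 0 0 * M (i + 1) (j + 1) - M 0 (i + 1) * M 0 (j + 1)

theorem sum_range_succ_quadratic (n : ℕ) (M : ℕ → ℕ → ℤ) (hM : ∀ i j, M i j = M j i) (x : ℕ → ℝ) :
    ∑ i ∈ range (n + 1), ∑ j ∈ range (n + 1), (M i j : ℝ) * x i * x j =
      M 0 0 * x 0 ^ 2 + 2 * x 0 * ∑ j ∈ range n, M 0 (j + 1) * x (j + 1) +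
        ∑ i ∈ range n, ∑ j ∈ range n, (M (i + 1) (j + 1) : ℝ) * x (i + 1) * x (j + 1) := by
  simp only [Finset.sum_range_succ' _ n, Finset.sum_add_distrib, Finset.mul_sum]
  have h1 : ∑ i ∈ range n, (M (i + 1) 0 : ℝ) * x (i + 1) * x 0 =
      ∑ i ∈ range n, x 0 * (M 0 (i + 1) * x (i + 1)) :=
    Finset.sum_congr rfl fun i _ => by rw [hM]; ring
  have h2 : ∑ i ∈ range n, (M 0 (i + 1) : ℝ) * x 0 * x (i + 1) =
      ∑ i ∈ range n, x 0 * (M 0 (i + 1) * x (i + 1)) :=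
    Finset.sum_congr rfl fun i _ => by ring
  have h3 : ∑ i ∈ range n, 2 * x 0 * (M 0 (i + 1) * x (i + 1)) =
      2 * ∑ i ∈ range n, x 0 * (M 0 (i + 1) * x (i + 1)) := by
    rw [Finset.mul_sum]; exact Finset.sum_congr rfl fun i _ => by ring
  rw [h1, h2, h3]
  ring

/-- For a positive pivot `m = M 0 0`, complete the square: `m (m x₀² + 2 x₀ R + S) = (m x₀ + R)² +
(m S - R²)`. The last bracket is the form of the reduced matrix, which is `m` times the Schur
complement. For a zero pivot the whole first row vanishes. -/
theorem nonneg_of_psdCheck (n : ℕ) (M : ℕ → ℕ → ℤ) (hM : ∀ i j, M i j = M j i)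
    (h : psdCheck n M = true) (x : ℕ → ℝ) :
    0 ≤ ∑ i ∈ range n, ∑ j ∈ range n, (M i j : ℝ) * x i * x j := by
  induction n generalizing M x with
  | zero => simp
  | succ n ih =>
    rw [sum_range_succ_quadratic n M hM]
    rw [psdCheck] at h
    by_cases h0 : M 0 0 = 0
    · simp only [h0, decide_true, cond_true, Bool.and_eq_true, List.all_eq_true, List.mem_range,
        decide_eq_true_eq] at h
      have hz : ∑ j ∈ range n, (M 0 (j + 1) : ℝ) * x (j + 1) = 0 :=
        Finset.sum_eq_zero fun j hj => by simp [h.1 j (Finset.mem_range.1 hj)]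
      rw [hz, h0]
      simpa using ih _ (fun i j => hM _ _) h.2 fun i => x (i + 1)
    · simp only [h0, decide_false, cond_false, Bool.and_eq_true, decide_eq_true_eq] at h
      have hpos : (0 : ℝ) < M 0 0 := by exact_mod_cast h.1
      have key := ih _ (fun i j => by rw [hM (i + 1), mul_comm (M 0 (i + 1))]) h.2
        fun i => x (i + 1)
      have expand : ∑ i ∈ range n, ∑ j ∈ range n,
          ((M 0 0 * M (i + 1) (j + 1) - M 0 (i + 1) * M 0 (j + 1) : ℤ) : ℝ) *
            x (i + 1) * x (j + 1) =
          M 0 0 * ∑ i ∈ range n, ∑ j ∈ range n, (M (i + 1) (j + 1) : ℝ) * x (i + 1) * x (j + 1) -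
            (∑ j ∈ range n, (M 0 (j + 1) : ℝ) * x (j + 1)) ^ 2 := by
        rw [sq, Finset.sum_mul_sum, Finset.mul_sum, ← Finset.sum_sub_distrib]
        refine Finset.sum_congr rfl fun i _ => ?_
        rw [Finset.mul_sum, ← Finset.sum_sub_distrib]
        refine Finset.sum_congr rfl fun j _ => ?_
        push_cast
        ring
      rw [expand] at key
      set R := ∑ j ∈ range n, (M 0 (j + 1) : ℝ) * x (j + 1)
      set S := ∑ i ∈ range n, ∑ j ∈ range n, (M (i + 1) (j + 1) : ℝ) * x (i + 1) * x (j + 1)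
      have : 0 ≤ (M 0 0 : ℝ) * (M 0 0 * x 0 ^ 2 + 2 * x 0 * R + S) := by
        nlinarith [sq_nonneg ((M 0 0 : ℝ) * x 0 + R)]
      exact nonneg_of_mul_nonneg_right this hpos

/-- The entries of the symmetric matrix given by the rows of its lower triangle. -/
def entry (M : List (List ℤ)) (i j : ℕ) : ℤ := (M.getD (max i j) []).getD (min i j) 0

theorem entry_comm (M : List (List ℤ)) (i j : ℕ) : entry M i j = entry M j i := by
  rw [entry, entry, max_comm, min_comm]

/-- The position of an index in a certificate. -/
def pos {n : ℕ} (a : Option (Fin n)) : ℕ := a.elim 0 fun i => i + 1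

/-- The real matrix given by the rows of its lower triangle. -/
def certMatrix (n : ℕ) (M : List (List ℤ)) : Matrix (Option (Fin n)) (Option (Fin n)) ℝ :=
  fun a b => entry M (pos a) (pos b)

theorem posSemidef_certMatrix {n : ℕ} {M : List (List ℤ)}
    (h : psdCheck (n + 1) (entry M) = true) : (certMatrix n M).PosSemidef := by
  refine .of_dotProduct_mulVec_nonneg (Matrix.IsHermitian.ext fun a b => ?_) fun x => ?_
  · simp [certMatrix, entry_comm M (pos a)]
  · let u : ℕ → ℝ := fun i => if h : i < n + 1 then x (finSuccEquiv n ⟨i, h⟩) else 0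
    have hu : ∀ i : Fin (n + 1), u i = x (finSuccEquiv n i) := fun i => by
      simp only [u, i.2, dif_pos, Fin.eta]
    have hp : ∀ i : Fin (n + 1), pos (finSuccEquiv n i) = i := fun i => by
      cases i using Fin.cases <;> simp [pos]
    have := nonneg_of_psdCheck (n + 1) _ (entry_comm M) h u
    refine this.trans_eq ?_
    simp only [dotProduct, Matrix.mulVec, Finset.mul_sum]
    rw [← (finSuccEquiv n).sum_comp, Finset.sum_range]
    refine Finset.sum_congr rfl fun i _ => ?_
    rw [← (finSuccEquiv n).sum_comp, Finset.sum_range]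
    refine Finset.sum_congr rfl fun j _ => ?_
    simp only [certMatrix, hp, hu, Pi.star_apply, star_trivial]
    ring

/-- The test whether a vector lies in the homogenized cone of the fractional stable set polytope of
the graph with the given edges. -/
def coneCheck (n : ℕ) (E : List (ℕ × ℕ)) (f : ℕ → ℤ) : Bool :=
  (List.range n).all (fun i => decide (0 ≤ f (i + 1)) && decide (f (i + 1) ≤ f 0)) &&
    (decide (0 ≤ f 0) && E.all fun e => decide (f (e.1 + 1) + f (e.2 + 1) ≤ f 0))

theorem mem_homCone_of_coneCheck {n : ℕ} {G : SimpleGraph (Fin n)} {E : List (ℕ × ℕ)}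
    (hE : ∀ i j, G.Adj i j → (i.1, j.1) ∈ E ∨ (j.1, i.1) ∈ E) {f : ℕ → ℤ}
    (h : coneCheck n E f = true) : (fun a => (f (pos a) : ℝ)) ∈ homCone (FRAC G) := by
  simp only [coneCheck, Bool.and_eq_true, List.all_eq_true, List.mem_range,
    decide_eq_true_eq] at h
  obtain ⟨h1, h0, h2⟩ := h
  have h2' : ∀ i j : Fin n, G.Adj i j → f (i + 1) + f (j + 1) ≤ f 0 := fun i j hij => by
    rcases hE i j hij with h | h
    · exact h2 _ h
    · have := h2 _ h
      simp only at this
      linarith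
  rcases h0.eq_or_lt with h0 | h0
  · refine ⟨0, le_rfl, 0, ⟨by simp, by simp⟩, by simp [pos, ← h0], fun i => ?_⟩
    have := h1 i i.2
    have : f (i + 1) = 0 := by omega
    simp [pos, this]
  · have hR : (0 : ℝ) < f 0 := by exact_mod_cast h0
    refine ⟨f 0, hR.le, fun i => f (i + 1) / f 0, ⟨fun i => ⟨?_, ?_⟩, fun i j hij => ?_⟩, rfl,
      fun i => ?_⟩
    · have : (0 : ℝ) ≤ f (i + 1) := by exact_mod_cast (h1 i i.2).1
      positivity
    · rw [div_le_one hR]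
      exact_mod_cast (h1 i i.2).2
    · rw [← add_div, div_le_one hR]
      exact_mod_cast h2' i j hij
    · simp only [pos, Option.elim]
      field_simp

/-- The test whether the first column of a matrix equals its diagonal and the matrix is positive
semidefinite. -/
def diagCheck (n : ℕ) (M : List (List ℤ)) : Bool :=
  decide (0 < entry M 0 0) &&
    ((List.range n).all (fun i => decide (entry M (i + 1) 0 = entry M (i + 1) (i + 1))) &&
      psdCheck (n + 1) (entry M))

/-- The test whether a matrix lies in the lifted set of the fractional stable set polytope. -/
def liftCheck (n : ℕ) (E : List (ℕ × ℕ)) (M : List (List ℤ)) : Bool :=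
  diagCheck n M && (List.range n).all fun i =>
    coneCheck n E (fun a => entry M a (i + 1)) &&
      coneCheck n E fun a => entry M a 0 - entry M a (i + 1)

/-- The set `P` is left general because both levels use this: `FRAC G` for the inner matrices and
`LS (FRAC G)` for the outer one. -/
theorem mem_liftedLS_of_diagCheck {n : ℕ} {P : Set (Fin n → ℝ)} {M : List (List ℤ)}
    (h : diagCheck n M = true)
    (hP : ∀ i : Fin n, (fun a => certMatrix n M a (some i)) ∈ homCone P ∧
      (fun a => certMatrix n M a none - certMatrix n M a (some i)) ∈ homCone P) :
    certMatrix n M ∈ liftedLS P ∧ 0 < certMatrix n M none none := by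
  simp only [diagCheck, Bool.and_eq_true, List.all_eq_true, List.mem_range,
    decide_eq_true_eq] at h
  refine ⟨⟨posSemidef_certMatrix h.2.2, fun a => ?_, hP⟩, ?_⟩
  · rcases a with _ | i
    · rfl
    · simpa [certMatrix, pos] using h.2.1 i i.2
  · simpa [certMatrix, pos] using h.1

theorem mem_homCone_LS_of_liftCheck {n : ℕ} {G : SimpleGraph (Fin n)} {E : List (ℕ × ℕ)}
    (hE : ∀ i j, G.Adj i j → (i.1, j.1) ∈ E ∨ (j.1, i.1) ∈ E) {M : List (List ℤ)}
    (h : liftCheck n E M = true) :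
    (fun a => (entry M (pos a) 0 : ℝ)) ∈ homCone (LS (FRAC G)) := by
  simp only [liftCheck, Bool.and_eq_true, List.all_eq_true, List.mem_range] at h
  obtain ⟨h1, h2⟩ := mem_liftedLS_of_diagCheck (P := FRAC G) h.1 fun i =>
    ⟨mem_homCone_of_coneCheck hE (h.2 i i.2).1, by
      simpa [certMatrix, pos] using mem_homCone_of_coneCheck hE (h.2 i i.2).2⟩
  exact mem_homCone_LS h1 h2

/-- The test of a certificate for two applications of `LS` to the fractional stable set polytope:
the matrices in `A` and `B` certify the columns of `M` and their differences with the first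
column. -/
def secondLiftCheck (n : ℕ) (E : List (ℕ × ℕ)) (M : List (List ℤ)) (A B : List (List (List ℤ))) :
    Bool :=
  diagCheck n M && (List.range n).all fun i =>
    (liftCheck n E (A.getD i []) && liftCheck n E (B.getD i [])) &&
      (List.range (n + 1)).all fun a =>
        decide (entry M a (i + 1) = entry (A.getD i []) a 0) &&
          decide (entry M a 0 - entry M a (i + 1) = entry (B.getD i []) a 0)

theorem mem_LS_LS_of_secondLiftCheck {n : ℕ} {G : SimpleGraph (Fin n)} {E : List (ℕ × ℕ)}
    (hE : ∀ i j, G.Adj i j → (i.1, j.1) ∈ E ∨ (j.1, i.1) ∈ E) {M : List (List ℤ)}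
    {A B : List (List (List ℤ))} (h : secondLiftCheck n E M A B = true) :
    (fun i : Fin n => (entry M (i + 1) 0 / entry M 0 0 : ℝ)) ∈ LS (LS (FRAC G)) := by
  simp only [secondLiftCheck, Bool.and_eq_true, List.all_eq_true, List.mem_range,
    decide_eq_true_eq] at h
  have hpos : ∀ a : Option (Fin n), pos a < n + 1 := fun a => by
    rcases a with _ | i <;> simp [pos]
  obtain ⟨h1, h2⟩ := mem_liftedLS_of_diagCheck (P := LS (FRAC G)) h.1 fun i => by
    have hi := h.2 i i.2
    constructor
    · convert mem_homCone_LS_of_liftCheck hE hi.1.1 using 2 with a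
      rw [← (hi.2 _ (hpos a)).1]
      rfl
    · convert mem_homCone_LS_of_liftCheck hE hi.1.2 using 2 with a
      rw [← (hi.2 _ (hpos a)).2, Int.cast_sub]
      rfl
  have hc : (0 : ℝ) ≤ (certMatrix n M none none)⁻¹ := by positivity
  refine mem_of_mem_homCone (y := fun a => (entry M (pos a) 0 / entry M 0 0 : ℝ)) ?_ ?_
  · convert smul_mem_homCone (mem_homCone_LS h1 h2) hc using 2 with a
    simp [certMatrix, pos, div_eq_inv_mul]
  · have : (entry M 0 0 : ℝ) ≠ 0 := h2.ne'
    simp [pos, this]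

end Certificates

/-! ### The rank of the nine-vertex graph. -/

section NineGraph

/-- The edges of `nineGraph`. -/
def nineEdges : List (ℕ × ℕ) :=
  [(0, 1), (1, 2), (0, 2), (3, 4), (4, 5), (6, 7), (7, 8), (3, 2), (5, 0), (5, 1), (6, 1), (6, 2),
    (8, 0), (8, 1), (6, 5), (6, 3)]

theorem nineGraph_adj (i j : Fin 9) :
    nineGraph.Adj i j ↔ (i.1, j.1) ∈ nineEdges ∨ (j.1, i.1) ∈ nineEdges := by
  simp only [nineGraph, SimpleGraph.fromEdgeSet_adj, Set.mem_insert_iff, Set.mem_singleton_iff]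
  revert i j
  decide +kernel

/-- A positive semidefinite matrix certifying a point of `LS (LS (FRAC nineGraph))`. -/
def outerCert : List (List ℤ) :=
  [[20000],
   [5138, 5138],
   [2965, 0, 2965],
   [6930, 0, 0, 6930],
   [6282, 1327, 1631, 0, 6282],
   [10488, 3795, 1317, 3762, 0, 10488],
   [6488, 0, 0, 3156, 3318, 0, 6488],
   [3866, 2043, 0, 0, 0, 3825, 0, 3866],
   [11588, 3080, 2928, 4076, 4661, 4755, 3893, 0, 11588],
   [6264, 0, 0, 2841, 1599, 3642, 2583, 1813, 0, 6264]]

/-- Certificates for the columns of `outerCert`. -/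
def inCert : List (List (List ℤ)) :=
  [[[5138],
   [5138, 5138],
   [0, 0, 0],
   [0, 0, 0, 0],
   [1327, 1327, 0, 0, 1327],
   [3795, 3795, 0, 0, 0, 3795],
   [0, 0, 0, 0, 0, 0, 0],
   [2043, 2043, 0, 0, 0, 2034, 0, 2043],
   [3080, 3080, 0, 0, 1319, 1754, 0, 0, 3080],
   [0, 0, 0, 0, 0, 0, 0, 0, 0, 0]],
  [[2965],
   [0, 0],
   [2965, 0, 2965],
   [0, 0, 0, 0],
   [1631, 0, 1631, 0, 1631],
   [1317, 0, 1317, 0, 0, 1317],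
   [0, 0, 0, 0, 0, 0, 0],
   [0, 0, 0, 0, 0, 0, 0, 0],
   [2928, 0, 2928, 0, 1616, 1302, 0, 0, 2928],
   [0, 0, 0, 0, 0, 0, 0, 0, 0, 0]],
  [[6930],
   [0, 0],
   [0, 0, 0],
   [6930, 0, 0, 6930],
   [0, 0, 0, 0, 0],
   [3762, 0, 0, 3762, 0, 3762],
   [3156, 0, 0, 3156, 0, 0, 3156],
   [0, 0, 0, 0, 0, 0, 0, 0],
   [4076, 0, 0, 4076, 0, 2236, 1834, 0, 4076],
   [2841, 0, 0, 2841, 0, 1520, 1315, 0, 0, 2841]],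
  [[6282],
   [1327, 1327],
   [1631, 0, 1631],
   [0, 0, 0, 0],
   [6282, 1327, 1631, 0, 6282],
   [0, 0, 0, 0, 0, 0],
   [3318, 0, 0, 0, 3318, 0, 3318],
   [0, 0, 0, 0, 0, 0, 0, 0],
   [4661, 1318, 1622, 0, 4661, 0, 1774, 0, 4661],
   [1599, 0, 0, 0, 1599, 0, 1537, 0, 0, 1599]],
  [[10488],
   [3795, 3795],
   [1317, 0, 1317],
   [3762, 0, 0, 3762],
   [0, 0, 0, 0, 0],
   [10488, 3795, 1317, 3762, 0, 10488],
   [0, 0, 0, 0, 0, 0, 0],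
   [3825, 1924, 0, 0, 0, 3825, 0, 3825],
   [4755, 1869, 1315, 2019, 0, 4755, 0, 0, 4755],
   [3642, 0, 0, 1741, 0, 3642, 0, 1897, 0, 3642]],
  [[6488],
   [0, 0],
   [0, 0, 0],
   [3156, 0, 0, 3156],
   [3318, 0, 0, 0, 3318],
   [0, 0, 0, 0, 0, 0],
   [6488, 0, 0, 3156, 3318, 0, 6488],
   [0, 0, 0, 0, 0, 0, 0, 0],
   [3893, 0, 0, 1888, 1999, 0, 3893, 0, 3893],
   [2583, 0, 0, 1262, 1314, 0, 2583, 0, 0, 2583]],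
  [[3866],
   [2043, 2043],
   [0, 0, 0],
   [0, 0, 0, 0],
   [0, 0, 0, 0, 0],
   [3825, 2025, 0, 0, 0, 3825],
   [0, 0, 0, 0, 0, 0, 0],
   [3866, 2043, 0, 0, 0, 3825, 0, 3866],
   [0, 0, 0, 0, 0, 0, 0, 0, 0],
   [1813, 0, 0, 0, 0, 1795, 0, 1813, 0, 1813]],
  [[11588],
   [3080, 3080],
   [2928, 0, 2928],
   [4076, 0, 0, 4076],
   [4661, 1561, 1484, 0, 4661],
   [4755, 1515, 1442, 2198, 0, 4755],
   [3893, 0, 0, 1873, 2016, 0, 3893],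
   [0, 0, 0, 0, 0, 0, 0, 0],
   [11588, 3080, 2928, 4076, 4661, 4755, 3893, 0, 11588],
   [0, 0, 0, 0, 0, 0, 0, 0, 0, 0]],
  [[6264],
   [0, 0],
   [0, 0, 0],
   [2841, 0, 0, 2841],
   [1599, 0, 0, 0, 1599],
   [3642, 0, 0, 1837, 0, 3642],
   [2583, 0, 0, 993, 1579, 0, 2583],
   [1813, 0, 0, 0, 0, 1794, 0, 1813],
   [0, 0, 0, 0, 0, 0, 0, 0, 0],
   [6264, 0, 0, 2841, 1599, 3642, 2583, 1813, 0, 6264]]]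

/-- Certificates for the differences of the first and the other columns of `outerCert`. -/
def outCert : List (List (List ℤ)) :=
  [[[14862],
   [0, 0],
   [2965, 0, 2965],
   [6930, 0, 0, 6930],
   [4955, 0, 1473, 0, 4955],
   [6693, 0, 1486, 3926, 0, 6693],
   [6488, 0, 0, 2999, 3476, 0, 6488],
   [1823, 0, 0, 0, 0, 1818, 0, 1823],
   [8508, 0, 2936, 3745, 3165, 3685, 3795, 0, 8508],
   [6264, 0, 0, 3158, 1761, 2970, 2659, 1797, 0, 6264]],
  [[17035],
   [5138, 5138],
   [0, 0, 0],
   [6930, 0, 0, 6930],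
   [4651, 1159, 0, 0, 4651],
   [9171, 3917, 0, 3937, 0, 9171],
   [6488, 0, 0, 2938, 3437, 0, 6488],
   [3866, 1765, 0, 0, 0, 3770, 0, 3866],
   [8660, 3315, 0, 3787, 2905, 4443, 3792, 0, 8660],
   [6264, 0, 0, 3090, 1672, 3435, 2536, 2052, 0, 6264]],
  [[13070],
   [5138, 5138],
   [2965, 0, 2965],
   [0, 0, 0, 0],
   [6282, 1718, 1424, 0, 6282],
   [6726, 3403, 1526, 0, 0, 6726],
   [3332, 0, 0, 0, 3315, 0, 3332],
   [3866, 1928, 0, 0, 0, 3841, 0, 3866],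
   [7512, 3202, 2959, 0, 4687, 2802, 1846, 0, 7512],
   [3423, 0, 0, 0, 1466, 1921, 1479, 1925, 0, 3423]],
  [[13718],
   [3811, 3811],
   [1334, 0, 1334],
   [6930, 0, 0, 6930],
   [0, 0, 0, 0, 0],
   [10488, 3791, 1316, 3932, 0, 10488],
   [3170, 0, 0, 2981, 0, 0, 3170],
   [3866, 1875, 0, 0, 0, 3844, 0, 3866],
   [6927, 1925, 1326, 4257, 0, 5549, 1354, 0, 6927],
   [4665, 0, 0, 2663, 0, 2980, 1663, 1977, 0, 4665]],
  [[9512],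
   [1343, 1343],
   [1648, 0, 1648],
   [3168, 0, 0, 3168],
   [6282, 1313, 1641, 0, 6282],
   [0, 0, 0, 0, 0, 0],
   [6488, 0, 0, 3048, 3433, 0, 6488],
   [41, 21, 0, 0, 0, 0, 0, 41],
   [6833, 1311, 1639, 1864, 4945, 0, 3998, 0, 6833],
   [2622, 0, 0, 1286, 1316, 0, 2482, 16, 0, 2622]],
  [[13512],
   [5138, 5138],
   [2965, 0, 2965],
   [3774, 0, 0, 3774],
   [2964, 1396, 1466, 0, 2964],
   [10488, 3723, 1482, 3754, 0, 10488],
   [0, 0, 0, 0, 0, 0, 0],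
   [3866, 1909, 0, 0, 0, 3843, 0, 3866],
   [7695, 3220, 2957, 2044, 2064, 5607, 0, 0, 7695],
   [3681, 0, 0, 1722, 717, 2942, 0, 1943, 0, 3681]],
  [[16134],
   [3095, 3095],
   [2965, 0, 2965],
   [6930, 0, 0, 6930],
   [6282, 1541, 1476, 0, 6282],
   [6663, 1512, 1449, 4323, 0, 6663],
   [6488, 0, 0, 2554, 3881, 0, 6488],
   [0, 0, 0, 0, 0, 0, 0, 0],
   [11588, 3061, 2932, 3930, 5075, 5350, 3598, 0, 11588],
   [4451, 0, 0, 2967, 1167, 1273, 2856, 0, 0, 4451]],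
  [[8412],
   [2058, 2058],
   [37, 0, 37],
   [2854, 0, 0, 2854],
   [1621, 29, 15, 0, 1621],
   [5733, 2000, 15, 1849, 0, 5733],
   [2595, 0, 0, 991, 1565, 0, 2595],
   [3866, 1838, 0, 0, 0, 3846, 0, 3866],
   [0, 0, 0, 0, 0, 0, 0, 0, 0],
   [6264, 0, 0, 2833, 1559, 3704, 2540, 2011, 0, 6264]],
  [[13736],
   [5138, 5138],
   [2965, 0, 2965],
   [4089, 0, 0, 4089],
   [4683, 1742, 1397, 0, 4683],
   [6846, 3384, 1557, 2223, 0, 6846],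
   [3905, 0, 0, 1852, 2039, 0, 3905],
   [2053, 1938, 0, 0, 0, 1830, 0, 2053],
   [11588, 3177, 2933, 4055, 4643, 4982, 3873, 0, 11588],
   [0, 0, 0, 0, 0, 0, 0, 0, 0, 0]]]

theorem secondLiftCheck_nineGraph :
    secondLiftCheck 9 nineEdges outerCert inCert outCert = true := by
  decide +kernel

/-- Exhaustion over the `2⁹` Boolean vectors bounds the stability number; this supplies the
inequality that the certified point violates. -/
theorem nineGraph_stable_card_le (x : Fin 9 → Bool)
    (h : ∀ e ∈ nineEdges, (x (Fin.ofNat 9 e.1) && x (Fin.ofNat 9 e.2)) = false) :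
    ∑ i, (x i).toNat ≤ 3 := by
  have key : ∀ a b c d e f g h i : Bool, (a && b) = false → (b && c) = false → (a && c) = false →
      (d && e) = false → (e && f) = false → (g && h) = false → (h && i) = false →
      (d && c) = false → (f && a) = false → (f && b) = false → (g && b) = false →
      (g && c) = false → (i && a) = false → (i && b) = false → (g && f) = false →
      (g && d) = false → a.toNat + b.toNat + c.toNat + d.toNat + e.toNat + f.toNat + g.toNat +
        h.toNat + i.toNat ≤ 3 := by
    decide +kernel
  simp only [nineEdges, List.forall_mem_cons] at h
  simp only [Fin.sum_univ_succ, Fin.sum_univ_zero]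
  have := key (x 0) (x 1) (x 2) (x 3) (x 4) (x 5) (x 6) (x 7) (x 8)
    h.1 h.2.1 h.2.2.1 h.2.2.2.1 h.2.2.2.2.1 h.2.2.2.2.2.1 h.2.2.2.2.2.2.1 h.2.2.2.2.2.2.2.1
    h.2.2.2.2.2.2.2.2.1 h.2.2.2.2.2.2.2.2.2.1 h.2.2.2.2.2.2.2.2.2.2.1
    h.2.2.2.2.2.2.2.2.2.2.2.1 h.2.2.2.2.2.2.2.2.2.2.2.2.1 h.2.2.2.2.2.2.2.2.2.2.2.2.2.1
    h.2.2.2.2.2.2.2.2.2.2.2.2.2.2.1 h.2.2.2.2.2.2.2.2.2.2.2.2.2.2.2.1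
  refine le_trans (le_of_eq ?_) this
  simp only [add_assoc]
  rfl

theorem sum_le_of_mem_integerHull_nineGraph {x : Fin 9 → ℝ}
    (hx : x ∈ integerHull (FRAC nineGraph)) : ∑ i, x i ≤ 3 := by
  refine convexHull_min (t := {x : Fin 9 → ℝ | ∑ i, x i ≤ 3}) ?_ ?_ hx
  · rintro x ⟨⟨-, hE⟩, h01⟩
    have hx : ∀ i, x i = ((decide (x i = 1)).toNat : ℝ) := fun i => by
      rcases h01 i with h | h <;> simp [h]
    have := nineGraph_stable_card_le (fun i => decide (x i = 1)) fun e he => by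
      have hadj : nineGraph.Adj (Fin.ofNat 9 e.1) (Fin.ofNat 9 e.2) := by
        rw [nineGraph_adj]
        left
        revert e
        decide
      have := hE _ _ hadj
      by_contra hne
      simp only [Bool.not_eq_false, Bool.and_eq_true, decide_eq_true_eq] at hne
      rw [hne.1, hne.2] at this
      norm_num at this
    rw [Set.mem_ofPred_eq, Finset.sum_congr rfl fun i _ => hx i]
    exact_mod_cast this
  · refine convex_halfSpace_le (f := fun x : Fin 9 → ℝ => ∑ i, x i) ⟨fun x y => ?_, fun c x => ?_⟩ 3
    · simp [Finset.sum_add_distrib]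
    · simp [Finset.mul_sum]

theorem LS_LS_nineGraph_not_subset :
    ¬ LS (LS (FRAC nineGraph)) ⊆ integerHull (FRAC nineGraph) := by
  intro h
  have h1 := sum_le_of_mem_integerHull_nineGraph (h (mem_LS_LS_of_secondLiftCheck
    (fun i j => (nineGraph_adj i j).1) secondLiftCheck_nineGraph))
  rw [← Finset.sum_div, div_le_iff₀ (by norm_num [entry, outerCert])] at h1
  -- Below its top entry `20000`, the first column of `outerCert` sums to `60009 > 3 * 20000`.
  norm_num [Fin.sum_univ_succ, entry, outerCert] at h1

theorem iterate_LS_nineGraph_subset : LS^[3] (FRAC nineGraph) ⊆ integerHull (FRAC nineGraph) := by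
  intro x hx
  -- Deleting `1, 5, 6` leaves the path `4 - 3 - 2 - 0 - 8 - 7`, with `{3, 7, 0}` as one color
  -- class.
  refine mem_of_mem_iterate_LS (convex_convexHull ℝ _) (convex_FRAC _) (fun y hy => hy.1) [1, 5, 6]
    (T := ∅) (fun y hy _ hyl => ?_) hx (by simp)
  refine mem_integerHull_of_bipartite (S := {v | v ∈ [1, 5, 6]})
    (fun v => decide (v ∈ ({3, 7, 0} : Finset (Fin 9)))) ?_ hy hyl
  simp only [nineGraph_adj, Set.mem_ofPred_eq]
  decide +kernel

theorem isMinimal_nineGraph : IsMinimal nineGraph 3 := by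
  refine ⟨⟨?_, fun m hm => ?_⟩, inferInstance, by simp⟩
  · exact iterate_LS_nineGraph_subset.antisymm (integerHull_subset_iterate_LS (convex_FRAC _) 3)
  · by_contra! hlt
    refine LS_LS_nineGraph_not_subset ?_
    rw [← show LS^[m] (FRAC nineGraph) = integerHull (FRAC nineGraph) from hm]
    exact iterate_LS_antitone (convex_FRAC _) (show m ≤ 2 by omega)

end NineGraph

/-! ### Hubs and wings in stretched cliques, and the two membership claims. -/

section Stretching

/-- In a stretched clique, distinct vertices have distinct names and the neighbors of a hub are the
two wings with the same index. -/
theorem StretchedClique.hub_spec {n d : ℕ} {V : Type} {G : SimpleGraph V} {L : V → Label n}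
    (h : StretchedClique n d V G L) :
    Function.Injective L ∧ {i | ∃ u, L u = .hub i}.ncard = d ∧
      (∀ i, (∃ u, L u = .unstretched i) → (∀ u, L u ≠ .hub i) ∧ ∀ u a, L u ≠ .wing i a) ∧
      ∀ i u, L u = .hub i → (∀ w, G.Adj u w ↔ ∃ a, L w = .wing i a) ∧ ∀ a, ∃ w, L w = .wing i a := by
  induction h with
  | complete =>
    refine ⟨fun a b h => by simpa using h, ?_, by simp, fun i u h => by cases h⟩
    have : {i : Fin n | ∃ u : Fin n, (Label.unstretched u : Label n) = .hub i} = ∅ := by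
      ext; simp
    rw [this, Set.ncard_empty]
  | @stretch d V G L hG v i hv A hA ih =>
    obtain ⟨hinj, hcard, hun, hhub⟩ := ih
    -- The index `i` is fresh: no hub or wing carries it yet. This keeps names distinct and makes
    -- the number of hubs grow by one.
    obtain ⟨hnh, hnw⟩ := hun i ⟨v, hv⟩
    have hset : {k | ∃ u, stretchLabel L v i u = .hub k} = insert i {k | ∃ u, L u = .hub k} := by
      ext k
      constructor
      · rintro ⟨u | _ | a, hu⟩
        · exact Or.inr ⟨u, hu⟩
        · cases hu; exact Or.inl rfl
        · cases hu
      · rintro (rfl | ⟨u, hu⟩)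
        · exact ⟨.inr none, rfl⟩
        · exact ⟨.inl ⟨u, by rintro rfl; simp [hv] at hu⟩, hu⟩
    refine ⟨?_, ?_, ?_, ?_⟩
    · rintro (u | _ | a) (w | _ | b) h <;> simp only [stretchLabel] at h
      · exact congrArg Sum.inl (Subtype.ext (hinj h))
      · exact absurd h (hnh _)
      · exact absurd h (hnw _ _)
      · exact absurd h.symm (hnh _)
      · rfl
      · cases h
      · exact absurd h.symm (hnw _ _)
      · cases h
      · cases h; rfl
    · have : i ∉ {k | ∃ u, L u = .hub k} := fun ⟨u, hu⟩ => hnh u hu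
      rw [hset, Set.ncard_insert_of_notMem this, hcard]
    · rintro k ⟨u | _ | a, hu⟩
      · replace hu : L u = .unstretched k := hu
        have hki : k ≠ i := by
          rintro rfl
          exact u.2 (hinj (hu.trans hv.symm))
        obtain ⟨h1, h2⟩ := hun k ⟨u, hu⟩
        constructor
        · rintro (w | _ | b) h
          · exact h1 w h
          · cases h; exact hki rfl
          · cases h
        · rintro (w | _ | b) c h
          · exact h2 w c h
          · cases h
          · cases h; exact hki rfl
      · cases hu
      · cases hu
    · rintro k (u | _ | a) hu
      · replace hu : L u = .hub k := hu
        obtain ⟨h1, h2⟩ := hhub k u hu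
        have hki : k ≠ i := by rintro rfl; exact hnh u hu
        -- Neighbors of an old hub are wings, whereas `v` is unstretched. So the hub lies in no `A
        -- b`, and no new wing is attached to it.
        have hnadj : ¬ G.Adj u v := by simp [h1, hv]
        refine ⟨?_, fun a => ?_⟩
        · rintro (w | _ | b)
          · exact h1 w
          · simp [LSPlus.stretch, stretchAdj, stretchLabel]
          · simp only [LSPlus.stretch, stretchAdj, stretchLabel, Label.wing.injEq, hki.symm,
              false_and, exists_false, iff_false]
            intro hmem
            exact hnadj (G.adj_symm (show (u : V) ∈ G.neighborSet v from
              hA ▸ Set.mem_iUnion_of_mem b hmem))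
        · obtain ⟨w, hw⟩ := h2 a
          exact ⟨.inl ⟨w, by rintro rfl; simp [hv] at hw⟩, hw⟩
      · cases hu
        refine ⟨?_, fun a => ⟨.inr (some a), rfl⟩⟩
        rintro (w | _ | b)
        · simp [LSPlus.stretch, stretchAdj, stretchLabel, hnw]
        · simp [LSPlus.stretch, stretchLabel]
        · simp [LSPlus.stretch, stretchAdj, stretchLabel]
      · cases hu

theorem StretchedClique.exists_hubs {n : ℕ} {W : Type} {H : SimpleGraph W} {L : W → Label n}
    (h : StretchedClique n 2 W H L) :
    ∃ i j, i ≠ j ∧ (∃ u, L u = .hub i) ∧ ∃ u, L u = .hub j := by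
  obtain ⟨i, j, hij, he⟩ := Set.ncard_eq_two.1 h.hub_spec.2.1
  have hi : i ∈ {i | ∃ u, L u = .hub i} := he ▸ Set.mem_insert _ _
  have hj : j ∈ {i | ∃ u, L u = .hub i} := he ▸ Set.mem_insert_of_mem _ rfl
  exact ⟨i, j, hij, hi, hj⟩

theorem StretchedClique.hub_not_adj_three {n d : ℕ} {W : Type} {H : SimpleGraph W}
    {L : W → Label n} (h : StretchedClique n d W H L) {i : Fin n} {u : W} (hu : L u = .hub i)
    {x y z : W} (hx : H.Adj u x) (hy : H.Adj u y) (hz : H.Adj u z) (hxy : x ≠ y) (hxz : x ≠ z)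
    (hyz : y ≠ z) : False := by
  obtain ⟨hinj, -, -, hh⟩ := h.hub_spec
  obtain ⟨a, ha⟩ := ((hh i u hu).1 x).1 hx
  obtain ⟨b, hb⟩ := ((hh i u hu).1 y).1 hy
  obtain ⟨c, hc⟩ := ((hh i u hu).1 z).1 hz
  have hab : a ≠ b := by rintro rfl; exact hxy (hinj (ha.trans hb.symm))
  have hac : a ≠ c := by rintro rfl; exact hxz (hinj (ha.trans hc.symm))
  have hbc : b ≠ c := by rintro rfl; exact hyz (hinj (hb.trans hc.symm))
  omega

instance : DecidableRel nineGraph.Adj := fun i j => decidable_of_iff' _ (nineGraph_adj i j)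

/-- Three distinct neighbors rule a vertex out as a hub, which leaves only `4` and `7`. -/
theorem nineGraph_degree_cases : ∀ p : Fin 9, p = 4 ∨ p = 7 ∨ ∃ x y z : Fin 9,
    nineGraph.Adj p x ∧ nineGraph.Adj p y ∧ nineGraph.Adj p z ∧ x ≠ y ∧ x ≠ z ∧ y ≠ z := by
  decide +kernel

theorem not_singleWingEdges_of_iso {n : ℕ} {W : Type} {H : SimpleGraph W} {L : W → Label n}
    (h : StretchedClique n 2 W H L) (φ : nineGraph ≃g H) : ¬ SingleWingEdges H L := by
  intro hs
  obtain ⟨i, j, hij, ⟨u, hu⟩, ⟨w, hw⟩⟩ := h.exists_hubs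
  obtain ⟨hinj, -, -, hh⟩ := h.hub_spec
  have hub : ∀ k q, L q = .hub k → q = φ 4 ∨ q = φ 7 := fun k q hq => by
    rcases nineGraph_degree_cases (φ.symm q) with h4 | h7 | ⟨x, y, z, hx, hy, hz, hxy, hxz, hyz⟩
    · exact Or.inl (by rw [← h4, φ.apply_symm_apply])
    · exact Or.inr (by rw [← h7, φ.apply_symm_apply])
    · rw [← φ.map_adj_iff, φ.apply_symm_apply] at hx hy hz
      exact (h.hub_not_adj_three hq hx hy hz (φ.injective.ne hxy) (φ.injective.ne hxz)
        (φ.injective.ne hyz)).elim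
  have wings : ∀ k p q, L (φ p) = .hub k → nineGraph.Adj p q → ∃ a, L (φ q) = .wing k a :=
    fun k p q hp hpq => ((hh k _ hp).1 _).1 (φ.map_adj_iff.2 hpq)
  have main : ∀ i j, i ≠ j → L (φ 4) = .hub i → L (φ 7) = .hub j → False := by
    intro i j hij h4 h7
    obtain ⟨e, he⟩ := Set.ncard_eq_one.1 (hs i j hij ⟨_, h4⟩ ⟨_, h7⟩)
    obtain ⟨a3, h3⟩ := wings i 4 3 h4 (by decide)
    obtain ⟨a5, h5⟩ := wings i 4 5 h4 (by decide)
    obtain ⟨a6, h6⟩ := wings j 7 6 h7 (by decide)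
    -- The edges `36` and `56` share the wing `6` of one index and end in the two wings `3`, `5` of
    -- the other.
    have m1 : s(φ 3, φ 6) ∈ ({e} : Set (Sym2 W)) := he ▸
      ⟨φ.map_adj_iff.2 (by decide), φ 3, φ 6, a3, a6, h3, h6, rfl⟩
    have m2 : s(φ 5, φ 6) ∈ ({e} : Set (Sym2 W)) := he ▸
      ⟨φ.map_adj_iff.2 (by decide), φ 5, φ 6, a5, a6, h5, h6, rfl⟩
    rw [Set.mem_singleton_iff] at m1 m2
    have := m1.trans m2.symm
    rw [Sym2.congr_left] at this
    exact absurd (φ.injective this) (by decide)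
  have huw : u ≠ w := by
    rintro rfl
    rw [hu] at hw
    cases hw
    exact hij rfl
  rcases hub i u hu with rfl | rfl <;> rcases hub j w hw with rfl | rfl
  · exact huw rfl
  · exact main i j hij hu hw
  · exact main j i hij.symm hw hu
  · exact huw rfl

theorem not_memKHat_nineGraph (n : ℕ) : ¬ MemKHat n 2 nineGraph := by
  rintro ⟨W, H, L, h, hs, ⟨φ⟩⟩
  exact not_singleWingEdges_of_iso h φ hs

/-- The neighbors of the wings when stretching the vertex `3` of `K₅`. -/
def firstWings (j : Fin 2) : Set (Fin 5) := if j = 0 then {2, 4} else {0, 1, 4}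

/-- The neighbors of the wings when then stretching the vertex `4`. -/
def secondWings (j : Fin 2) : Set ({w : Fin 5 // w ≠ 3} ⊕ Option (Fin 2)) :=
  if j = 0 then {.inl ⟨1, by decide⟩, .inl ⟨2, by decide⟩, .inr (some 0), .inr (some 1)}
  else {.inl ⟨0, by decide⟩, .inl ⟨1, by decide⟩}

/-- The vertex `4` of the graph obtained from `K₅` by stretching the vertex `3`. -/
def lastVertex : {w : Fin 5 // w ≠ 3} ⊕ Option (Fin 2) := .inl ⟨4, by decide⟩

/-- The vertices of `nineGraph` as vertices of the twice stretched `K₅`. -/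
def nineVertex : Fin 9 →
    {w : {w : Fin 5 // w ≠ 3} ⊕ Option (Fin 2) // w ≠ lastVertex} ⊕ Option (Fin 2) :=
  ![.inl ⟨.inl ⟨0, by decide⟩, by decide⟩, .inl ⟨.inl ⟨1, by decide⟩, by decide⟩,
    .inl ⟨.inl ⟨2, by decide⟩, by decide⟩, .inl ⟨.inr (some 0), by decide⟩,
    .inl ⟨.inr none, by decide⟩, .inl ⟨.inr (some 1), by decide⟩,
    .inr (some 0), .inr none, .inr (some 1)]

theorem nineVertex_bijective : Function.Bijective nineVertex := by
  constructor
  · decide +kernel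
  · decide +kernel

instance (j : Fin 2) (w : Fin 5) : Decidable (w ∈ firstWings j) := by
  unfold firstWings; split_ifs <;> infer_instance

instance (j : Fin 2) (w : {w : Fin 5 // w ≠ 3} ⊕ Option (Fin 2)) :
    Decidable (w ∈ secondWings j) := by
  unfold secondWings; split_ifs <;> infer_instance

instance decidableStretchAdj {V J : Type} (G : SimpleGraph V) [DecidableRel G.Adj] (v : V)
    (A : J → Set V) [∀ j w, Decidable (w ∈ A j)] : DecidableRel (stretch G v A).Adj
  | .inl a, .inl b => inferInstanceAs (Decidable (G.Adj a b))
  | .inl a, .inr (some j) => inferInstanceAs (Decidable ((a : V) ∈ A j))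
  | .inr (some j), .inl a => inferInstanceAs (Decidable ((a : V) ∈ A j))
  | .inr none, .inr (some _) => inferInstanceAs (Decidable True)
  | .inr (some _), .inr none => inferInstanceAs (Decidable True)
  | .inl _, .inr none => inferInstanceAs (Decidable False)
  | .inr none, .inl _ => inferInstanceAs (Decidable False)
  | .inr none, .inr none => inferInstanceAs (Decidable False)
  | .inr (some _), .inr (some _) => inferInstanceAs (Decidable False)

theorem memK_nineGraph : MemK 5 2 nineGraph := by
  -- Both wings of the vertex `3` are joined to the vertex `4`, and the first wing of `4` inherits
  -- both edges; this overlap creates the two edges between wings.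
  refine ⟨_, _, _, .stretch (.stretch .complete 3 3 rfl firstWings ?_) lastVertex 4 rfl
    secondWings ?_, ⟨⟨Equiv.ofBijective nineVertex nineVertex_bijective, ?_⟩⟩⟩
  · ext w
    rw [Set.mem_iUnion, SimpleGraph.mem_neighborSet]
    revert w
    decide +kernel
  · ext w
    rw [Set.mem_iUnion, SimpleGraph.mem_neighborSet]
    revert w
    decide +kernel
  · simp only [Equiv.ofBijective_apply]
    intro a b
    revert a b
    decide +kernel

end Stretching

end LSPlus

theorem proposition5p6 :
    LSPlus.MemK 5 2 LSPlus.nineGraph ∧ ¬ LSPlus.MemKHat 5 2 LSPlus.nineGraph ∧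
      LSPlus.IsMinimal LSPlus.nineGraph 3 :=
  ⟨LSPlus.memK_nineGraph, LSPlus.not_memKHat_nineGraph 5, LSPlus.isMinimal_nineGraph⟩
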